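/- Let $(g_n(k))$ and $(h_n(k))$ $(n\ge 1,\ 1\le k\le 2n-1)$ be the triangles of rational numbers that are the unique solutions of the finite difference system $$f_n(k+2)-2f_n(k+1)+f_n(k)+4f_{n-1}(k)=0\qquad(n\ge 2,\ 1\le k\le 2n-3)$$ with the following initial values, where $\sum_k f_{n-1}(k)$ runs over $1\le k\le 2n-3$: - for $f=g$ (the tangent triangle): $g_1(1)=1$, and $g_n(1)=0$, $g_n(2)=2\sum_k g_{n-1}(k)$ for $n\ge 2$; - for $f=h$ (the secant triangle): $h_1(1)=1$, and $h_n(1)=\sum_k h_{n-1}(k)$, $h_n(2)=3\sum_k h_{n-1}(k)$ for $n\ge 2$. For such a triangle $f$ define the formal power series $$Z(x,y)=1+\sum_{n\ge 1}\ \sum_{1\le k\le 2n+1} f_{n+1}(k)\,\frac{x^{2n+1-k}}{(2n+1-k)!}\,\frac{y^{k-1}}{(k-1)!}\in\mathbb{Q}[[x,y]],$$ and write $Z^{\tan}$ and $Z^{\sec}$ for it when $f=g$ and $f=h$, respectively. Then, as formal power series, $$Z^{\tan}(x,y)=\sec(x+y)\cos(x-y),\qquad Z^{\sec}(x,y)=\sec^2(x+y)\cos(x-y).$$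 -/

import Mathlib

/-- The finite difference equation system `Δ² f_n(k) + 4 f_{n-1}(k) = 0` for `n ≥ 2` and
`1 ≤ k ≤ 2n - 3`. The triangle is `f_n(k) = f n k` with `n ≥ 1`, `1 ≤ k ≤ 2n - 1`; the values of `f`
at other indices play no role. -/
def IsDifferenceSolution (f : ℕ → ℕ → ℚ) : Prop :=
  ∀ n k : ℕ, 2 ≤ n → 1 ≤ k → k ≤ 2 * n - 3 →
    (f n (k + 2) - 2 * f n (k + 1) + f n k) + 4 * f (n - 1) k = 0

/-- The sum `∑_k f_n(k)` of the `n`-th row, over `1 ≤ k ≤ 2n - 1`. -/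
def rowSum (f : ℕ → ℕ → ℚ) (n : ℕ) : ℚ :=
  ∑ k ∈ Finset.Icc 1 (2 * n - 1), f n k

/-- `f` is the tangent triangle: the solution of the system with `f_1(1) = 1`, and `f_n(1) = 0`,
`f_n(2) = 2 ∑_k f_{n-1}(k)` for `n ≥ 2`. -/
structure IsTangentTriangle (f : ℕ → ℕ → ℚ) : Prop where
  difference : IsDifferenceSolution f
  apex : f 1 1 = 1
  first : ∀ n : ℕ, 2 ≤ n → f n 1 = 0
  second : ∀ n : ℕ, 2 ≤ n → f n 2 = 2 * rowSum f (n - 1)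

/-- `f` is the secant triangle: the solution of the system with `f_1(1) = 1`, and
`f_n(1) = ∑_k f_{n-1}(k)`, `f_n(2) = 3 ∑_k f_{n-1}(k)` for `n ≥ 2`. -/
structure IsSecantTriangle (f : ℕ → ℕ → ℚ) : Prop where
  difference : IsDifferenceSolution f
  apex : f 1 1 = 1
  first : ∀ n : ℕ, 2 ≤ n → f n 1 = rowSum f (n - 1)
  second : ∀ n : ℕ, 2 ≤ n → f n 2 = 3 * rowSum f (n - 1)

/-- The row determined by the previous row `p` and by its first two entries `a`, `b`. -/
def nextRow (p : ℕ → ℚ) (a b : ℚ) : ℕ → ℚ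
  | 0 => 0
  | 1 => a
  | 2 => b
  | k + 3 => 2 * nextRow p a b (k + 2) - nextRow p a b (k + 1) - 4 * p (k + 1)

/-- The triangle whose `n`-th row starts with `c S`, `d S` for `n ≥ 2`, where `S` is the sum of
the row above. -/
def buildTriangle (c d : ℚ) : ℕ → ℕ → ℚ
  | 0 => fun _ => 0
  | 1 => fun _ => 1
  | n + 2 =>
    let p := buildTriangle c d (n + 1)
    let S := ∑ k ∈ Finset.Icc 1 (2 * (n + 1) - 1), p k
    nextRow p (c * S) (d * S)

theorem isDifferenceSolution_buildTriangle (c d : ℚ) :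
    IsDifferenceSolution (buildTriangle c d) := by
  intro n k hn hk _
  obtain ⟨n, rfl⟩ : ∃ m, n = m + 2 := ⟨n - 2, by omega⟩
  obtain ⟨k, rfl⟩ : ∃ m, k = m + 1 := ⟨k - 1, by omega⟩
  simp only [buildTriangle, show n + 2 - 1 = n + 1 from rfl]
  rw [show k + 1 + 2 = k + 3 from rfl, nextRow]
  ring

/-- The tangent triangle exists. -/
theorem exists_isTangentTriangle : ∃ f, IsTangentTriangle f := by
  refine ⟨buildTriangle 0 2, isDifferenceSolution_buildTriangle 0 2, rfl, ?_, ?_⟩ <;>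
  · intro n hn
    obtain ⟨n, rfl⟩ : ∃ m, n = m + 2 := ⟨n - 2, by omega⟩
    simp [buildTriangle, nextRow, rowSum]

/-- The secant triangle exists. -/
theorem exists_isSecantTriangle : ∃ f, IsSecantTriangle f := by
  refine ⟨buildTriangle 1 3, isDifferenceSolution_buildTriangle 1 3, rfl, ?_, ?_⟩ <;>
  · intro n hn
    obtain ⟨n, rfl⟩ : ∃ m, n = m + 2 := ⟨n - 2, by omega⟩
    simp [buildTriangle, nextRow, rowSum]

/-- The double sum
`∑_{n ≥ 1} ∑_{1 ≤ k ≤ 2n+1} f_{n+1}(k) x^{2n+1-k}/(2n+1-k)! y^{k-1}/(k-1)!`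
as a formal power series in `x = X 0` and `y = X 1`, given by its coefficients: the pair `(n, k)`
contributes to the monomial `x^i y^j` exactly when `i + j = 2n` and `j = k - 1`. -/
noncomputable def genSum (f : ℕ → ℕ → ℚ) : MvPowerSeries (Fin 2) ℚ := fun d =>
  if Even (d 0 + d 1) ∧ 1 ≤ (d 0 + d 1) / 2 then
    f ((d 0 + d 1) / 2 + 1) (d 1 + 1) / ((d 0).factorial * (d 1).factorial)
  else 0

/-- The generating function `Z(x,y) = 1 + ∑_{n ≥ 1} ∑_{1 ≤ k ≤ 2n+1} …` of a triangle. -/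
noncomputable def genFun (f : ℕ → ℕ → ℚ) : MvPowerSeries (Fin 2) ℚ := 1 + genSum f

/-- The power series of `sec = 1 / cos`. -/
noncomputable def secSeries : PowerSeries ℚ := (PowerSeries.cos ℚ)⁻¹

/-! Let `Z = A(x + y) cos(x - y)`. The operator `∂_x - ∂_y` kills `A(x + y)`, and its square
multiplies `cos(x - y)` by `-4`, so `(∂_x - ∂_y)² Z = -4 Z`. Read off on the coefficients of `x^i/i!
y^j/j!`, this is the difference system.

Summing second differences along a row telescopes to the first difference minus the last one. As `Z`
is symmetric in `x` and `y`, rows are palindromic and these two are opposite, so `f_n(2) - f_n(1) =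
2 ∑_k f_{n-1}(k)` for every `A` (`two_mul_rowSum_triangleOf`).

The other initial condition is read at `y = 0`. For `A = sec`, `Z(x, 0) = 1` gives `f_n(1) = 0`; for
`A = sec²`, `∂_y Z = 3 ∂_x Z` there gives `f_n(2) = 3 f_n(1)`. Uniqueness of the solution
(`IsDifferenceSolution.eq_of_initial`) concludes. -/

open MvPowerSeries (pderiv)

/-! ### Substituting `x + y` and `x - y` into a one-variable series -/

namespace PowerSeries

/-- `A(x + y)`. -/
noncomputable def substAdd (A : PowerSeries ℚ) : MvPowerSeries (Fin 2) ℚ :=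
  A.subst (MvPowerSeries.X 0 + MvPowerSeries.X 1 : MvPowerSeries (Fin 2) ℚ)

/-- `A(x - y)`. -/
noncomputable def substSub (A : PowerSeries ℚ) : MvPowerSeries (Fin 2) ℚ :=
  A.subst (MvPowerSeries.X 0 - MvPowerSeries.X 1 : MvPowerSeries (Fin 2) ℚ)

theorem hasSubst_X_add_X :
    HasSubst (MvPowerSeries.X 0 + MvPowerSeries.X 1 : MvPowerSeries (Fin 2) ℚ) :=
  HasSubst.of_constantCoeff_zero (by simp)

theorem substAdd_mul (A B : PowerSeries ℚ) : substAdd (A * B) = substAdd A * substAdd B :=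
  subst_mul hasSubst_X_add_X A B

theorem substAdd_pow (A : PowerSeries ℚ) (n : ℕ) : substAdd (A ^ n) = substAdd A ^ n :=
  subst_pow hasSubst_X_add_X A n

theorem substAdd_one : substAdd 1 = 1 := by
  rw [substAdd, ← coe_substAlgHom hasSubst_X_add_X, map_one]

theorem coeff_substAdd (A : PowerSeries ℚ) (e : Fin 2 →₀ ℕ) :
    MvPowerSeries.coeff e (substAdd A) =
      (e 0 + e 1).choose (e 0) * coeff (e 0 + e 1) A :=
  coeff_subst_X_zero_add_X_one A e

theorem coeff_rescale_fin_two (F : MvPowerSeries (Fin 2) ℚ) (a : Fin 2 → ℚ) (e : Fin 2 →₀ ℕ) :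
    MvPowerSeries.coeff e (MvPowerSeries.rescale a F) =
      a 0 ^ e 0 * a 1 ^ e 1 * MvPowerSeries.coeff e F := by
  rw [MvPowerSeries.coeff_rescale, Finsupp.prod_fintype _ _ (by simp), Fin.prod_univ_two]

/-- The sign change `y ↦ -y` transfers coefficient and derivative formulas from `A(x + y)` to `A(x -
y)`. -/
theorem substSub_eq_rescale (A : PowerSeries ℚ) :
    substSub A = MvPowerSeries.rescale ![1, -1] (substAdd A) := by
  have hs : MvPowerSeries.HasSubst
      ((![1, -1] : Fin 2 → ℚ) • (MvPowerSeries.X : Fin 2 → MvPowerSeries (Fin 2) ℚ)) :=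
    MvPowerSeries.HasSubst.smul_X _
  rw [MvPowerSeries.rescale_eq_subst, substAdd, PowerSeries.subst,
    MvPowerSeries.subst_comp_subst_apply hasSubst_X_add_X.const hs,
    MvPowerSeries.subst_add hs, MvPowerSeries.subst_X hs, MvPowerSeries.subst_X hs, substSub,
    PowerSeries.subst]
  congr 1
  simp [sub_eq_add_neg]

theorem coeff_substSub (A : PowerSeries ℚ) (e : Fin 2 →₀ ℕ) :
    MvPowerSeries.coeff e (substSub A) =
      (-1) ^ e 1 * ((e 0 + e 1).choose (e 0) * coeff (e 0 + e 1) A) := by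
  simp [substSub_eq_rescale, coeff_substAdd]

theorem choose_succ_mul_succ_left (i j : ℕ) :
    ((i + 1 + j).choose (i + 1) : ℚ) * (i + 1) = (i + j).choose i * (i + j + 1) := by
  have := Nat.add_one_mul_choose_eq (i + j) i
  rw [show i + 1 + j = i + j + 1 by ring]
  exact_mod_cast (by linarith :
    (i + j + 1).choose (i + 1) * (i + 1) = (i + j).choose i * (i + j + 1))

theorem choose_succ_mul_succ_right (i j : ℕ) :
    ((i + (j + 1)).choose i : ℚ) * (j + 1) = (i + j).choose i * (i + j + 1) := by
  have := choose_succ_mul_succ_left j i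
  rw [add_comm (j + 1) i, add_comm j i, ← Nat.choose_symm_add, ← Nat.choose_symm_add] at this
  linarith

theorem pderiv_substAdd (A : PowerSeries ℚ) (t : Fin 2) :
    pderiv ℚ t (substAdd A) = substAdd (derivative ℚ A) := by
  ext e
  rw [MvPowerSeries.coeff_pderiv, coeff_substAdd, coeff_substAdd, coeff_derivative]
  fin_cases t
  · have := choose_succ_mul_succ_left (e 0) (e 1)
    simp only [Fin.zero_eta, Finsupp.add_apply, Finsupp.single_eq_same, Nat.cast_add]
    simp only [Finsupp.single_apply, zero_ne_one, if_false, add_zero]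
    rw [show e 0 + 1 + e 1 = e 0 + e 1 + 1 by ring] at *
    linear_combination coeff (e 0 + e 1 + 1) A * this
  · have := choose_succ_mul_succ_right (e 0) (e 1)
    simp only [Fin.mk_one, Finsupp.add_apply, Finsupp.single_eq_same, Nat.cast_add]
    simp only [Finsupp.single_apply, one_ne_zero, if_false, add_zero]
    rw [← add_assoc] at *
    linear_combination coeff (e 0 + e 1 + 1) A * this

theorem pderiv_zero_substSub (A : PowerSeries ℚ) :
    pderiv ℚ 0 (substSub A) = substSub (derivative ℚ A) := by
  ext e
  have := congrArg (MvPowerSeries.coeff e) (pderiv_substAdd A 0)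
  rw [MvPowerSeries.coeff_pderiv] at *
  rw [substSub_eq_rescale, substSub_eq_rescale, coeff_rescale_fin_two, coeff_rescale_fin_two,
    ← this]
  simp
  ring

theorem pderiv_one_substSub (A : PowerSeries ℚ) :
    pderiv ℚ 1 (substSub A) = -substSub (derivative ℚ A) := by
  ext e
  have := congrArg (MvPowerSeries.coeff e) (pderiv_substAdd A 1)
  rw [MvPowerSeries.coeff_pderiv] at *
  rw [map_neg, substSub_eq_rescale, substSub_eq_rescale, coeff_rescale_fin_two,
    coeff_rescale_fin_two, ← this]
  simp
  ring

/-- Setting `y = 0` does not distinguish `A(x - y)` from `A(x + y)`. -/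
theorem rescale_substSub (A : PowerSeries ℚ) :
    MvPowerSeries.rescale ![1, 0] (substSub A) = MvPowerSeries.rescale ![1, 0] (substAdd A) := by
  rw [substSub_eq_rescale, MvPowerSeries.rescale_rescale]
  congr 2
  ext t
  fin_cases t <;> simp

/-! ### Cosine, parity and symmetry -/

theorem derivative_derivative_cos : derivative ℚ (derivative ℚ (cos ℚ)) = -cos ℚ := by
  ext n
  simp only [coeff_derivative, cos, coeff_mk, map_neg, Nat.even_add_one, not_not]
  split_ifs with h
  · obtain ⟨m, rfl⟩ := h
    rw [show (m + m + 1 + 1) / 2 = m + 1 by omega, show (m + m) / 2 = m by omega,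
      Nat.factorial_succ, Nat.factorial_succ]
    have := Nat.factorial_ne_zero (m + m)
    simp only [Algebra.algebraMap_self, RingHom.id_apply]
    push_cast
    field_simp
    ring
  · simp

theorem coeff_cos_of_odd {n : ℕ} (hn : Odd n) : coeff n (cos ℚ) = 0 := by
  simp [cos, Nat.not_even_iff_odd.mpr hn]

theorem constantCoeff_cos : constantCoeff (cos ℚ) = 1 := by
  rw [← coeff_zero_eq_constantCoeff_apply]
  simp [cos]

theorem rescale_neg_one_cos : PowerSeries.rescale (-1 : ℚ) (cos ℚ) = cos ℚ := by
  ext n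
  rw [coeff_rescale]
  rcases Nat.even_or_odd n with h | h
  · simp [h.neg_one_pow]
  · simp [coeff_cos_of_odd h]

theorem rescale_neg_one_substAdd {A : PowerSeries ℚ} (hA : PowerSeries.rescale (-1 : ℚ) A = A) :
    MvPowerSeries.rescale (fun _ => -1) (substAdd A) = substAdd A := by
  ext e
  have := congrArg (coeff (e 0 + e 1)) hA
  rw [coeff_rescale] at this
  rw [coeff_rescale_fin_two, coeff_substAdd, ← pow_add]
  linear_combination ((e 0 + e 1).choose (e 0) : ℚ) * this

theorem rescale_neg_one_substSub {A : PowerSeries ℚ} (hA : PowerSeries.rescale (-1 : ℚ) A = A) :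
    MvPowerSeries.rescale (fun _ => -1) (substSub A) = substSub A := by
  rw [substSub_eq_rescale, MvPowerSeries.rescale_rescale, mul_comm, ← MvPowerSeries.rescale_rescale,
    rescale_neg_one_substAdd hA]

/-- Exchanging the two variables. -/
noncomputable def swapVars : MvPowerSeries (Fin 2) ℚ →ₐ[ℚ] MvPowerSeries (Fin 2) ℚ :=
  MvPowerSeries.rename (Equiv.swap (0 : Fin 2) 1).toEmbedding

theorem coeff_swapVars (F : MvPowerSeries (Fin 2) ℚ) (i j : ℕ) :
    MvPowerSeries.coeff (Finsupp.single 0 i + Finsupp.single 1 j) (swapVars F) =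
      MvPowerSeries.coeff (Finsupp.single 0 j + Finsupp.single 1 i) F := by
  rw [← MvPowerSeries.coeff_embDomain_rename (Equiv.swap (0 : Fin 2) 1).toEmbedding F, swapVars]
  congr 1
  rw [Finsupp.embDomain_add, Finsupp.embDomain_single, Finsupp.embDomain_single]
  simp [add_comm]

theorem ext_single {F G : MvPowerSeries (Fin 2) ℚ}
    (h : ∀ i j, MvPowerSeries.coeff (Finsupp.single 0 i + Finsupp.single 1 j) F =
      MvPowerSeries.coeff (Finsupp.single 0 i + Finsupp.single 1 j) G) : F = G := by
  ext e
  have he : e = Finsupp.single 0 (e 0) + Finsupp.single 1 (e 1) := by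
    ext t
    fin_cases t <;> simp
  rw [he]
  exact h _ _

theorem swapVars_substAdd (A : PowerSeries ℚ) : swapVars (substAdd A) = substAdd A := by
  refine ext_single fun i j => ?_
  rw [coeff_swapVars, coeff_substAdd, coeff_substAdd]
  simp [add_comm j i, ← Nat.choose_symm_add (a := i) (b := j)]

/-- The swap replaces the sign `(-1)^j` by `(-1)^i`; these agree when `i + j` is even, and otherwise
the coefficient of `cos` vanishes. -/
theorem swapVars_substSub_cos : swapVars (substSub (cos ℚ)) = substSub (cos ℚ) := by
  refine ext_single fun i j => ?_
  rw [coeff_swapVars, coeff_substSub, coeff_substSub]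
  simp only [Finsupp.add_apply, Finsupp.single_apply, one_ne_zero, zero_ne_one, if_true, if_false,
    add_zero, zero_add, add_comm j i]
  rw [Nat.choose_symm_add]
  rcases Nat.even_or_odd (i + j) with h | h
  · congr 1
    rcases Nat.even_or_odd i with hi | hi
    · rw [hi.neg_one_pow, ((Nat.even_add.mp h).mp hi).neg_one_pow]
    · rw [hi.neg_one_pow, (Nat.even_add'.mp h |>.mp hi).neg_one_pow]
  · simp [coeff_cos_of_odd h]

end PowerSeries

open PowerSeries

theorem secSeries_mul_cos : secSeries * PowerSeries.cos ℚ = 1 :=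
  PowerSeries.inv_mul_cancel _ (by simp [constantCoeff_cos])

/-- Both sides are inverses of the even series `cos`. -/
theorem rescale_neg_one_secSeries : PowerSeries.rescale (-1 : ℚ) secSeries = secSeries := by
  have h : PowerSeries.rescale (-1 : ℚ) secSeries * PowerSeries.cos ℚ = 1 := by
    conv_lhs => rw [← rescale_neg_one_cos]
    rw [← map_mul, secSeries_mul_cos, map_one]
  linear_combination secSeries * h - PowerSeries.rescale (-1 : ℚ) secSeries * secSeries_mul_cos

theorem derivative_secSeries :
    derivative ℚ secSeries = -secSeries ^ 2 * derivative ℚ (PowerSeries.cos ℚ) :=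
  derivative_inv' _

/-! ### The series `A(x + y) cos(x - y)` and its coefficients -/

/-- `A(x + y) cos(x - y)`. -/
noncomputable def mulCosSub (A : PowerSeries ℚ) : MvPowerSeries (Fin 2) ℚ :=
  substAdd A * substSub (PowerSeries.cos ℚ)

theorem pderiv_zero_mulCosSub (A : PowerSeries ℚ) :
    pderiv ℚ 0 (mulCosSub A) = substAdd (derivative ℚ A) * substSub (PowerSeries.cos ℚ) +
      substAdd A * substSub (derivative ℚ (PowerSeries.cos ℚ)) := by
  rw [mulCosSub, Derivation.leibniz, pderiv_substAdd, pderiv_zero_substSub, smul_eq_mul,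
    smul_eq_mul]
  ring

theorem pderiv_one_mulCosSub (A : PowerSeries ℚ) :
    pderiv ℚ 1 (mulCosSub A) = substAdd (derivative ℚ A) * substSub (PowerSeries.cos ℚ) -
      substAdd A * substSub (derivative ℚ (PowerSeries.cos ℚ)) := by
  rw [mulCosSub, Derivation.leibniz, pderiv_substAdd, pderiv_one_substSub, smul_eq_mul,
    smul_eq_mul]
  ring

/-- `(∂_x - ∂_y)² Z + 4 Z = 0` for `Z = A(x + y) cos(x - y)`. -/
theorem pderiv_pderiv_mulCosSub (A : PowerSeries ℚ) :
    pderiv ℚ 1 (pderiv ℚ 1 (mulCosSub A)) - 2 * pderiv ℚ 0 (pderiv ℚ 1 (mulCosSub A)) +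
      pderiv ℚ 0 (pderiv ℚ 0 (mulCosSub A)) + 4 * mulCosSub A = 0 := by
  have hc : substSub (derivative ℚ (derivative ℚ (PowerSeries.cos ℚ))) =
      -substSub (PowerSeries.cos ℚ) := by
    rw [derivative_derivative_cos]
    ext e
    simp [coeff_substSub]
  rw [pderiv_zero_mulCosSub, pderiv_one_mulCosSub, map_add, map_sub, map_sub, mulCosSub]
  -- All terms containing a derivative of `A` cancel, leaving `4 A(x + y) cos''(x - y)` against `4
  -- Z`.
  simp only [Derivation.leibniz, pderiv_substAdd, pderiv_zero_substSub, pderiv_one_substSub,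
    smul_eq_mul, hc]
  ring

/-- The coefficient of `x^i/i! y^j/j!`. -/
noncomputable def expCoeff (Z : MvPowerSeries (Fin 2) ℚ) (i j : ℕ) : ℚ :=
  i.factorial * j.factorial * MvPowerSeries.coeff (Finsupp.single 0 i + Finsupp.single 1 j) Z

theorem expCoeff_pderiv_zero (Z : MvPowerSeries (Fin 2) ℚ) (i j : ℕ) :
    expCoeff (pderiv ℚ 0 Z) i j = expCoeff Z (i + 1) j := by
  rw [expCoeff, expCoeff, MvPowerSeries.coeff_pderiv, add_right_comm, ← Finsupp.single_add,
    Nat.factorial_succ]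
  simp
  ring

theorem expCoeff_pderiv_one (Z : MvPowerSeries (Fin 2) ℚ) (i j : ℕ) :
    expCoeff (pderiv ℚ 1 Z) i j = expCoeff Z i (j + 1) := by
  rw [expCoeff, expCoeff, MvPowerSeries.coeff_pderiv, add_assoc, ← Finsupp.single_add,
    Nat.factorial_succ]
  simp
  ring

theorem expCoeff_rescale (Z : MvPowerSeries (Fin 2) ℚ) (a : Fin 2 → ℚ) (i j : ℕ) :
    expCoeff (MvPowerSeries.rescale a Z) i j = a 0 ^ i * a 1 ^ j * expCoeff Z i j := by
  rw [expCoeff, expCoeff, coeff_rescale_fin_two]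
  simp
  ring

theorem expCoeff_mulCosSub_recurrence (A : PowerSeries ℚ) (i j : ℕ) :
    expCoeff (mulCosSub A) i (j + 2) - 2 * expCoeff (mulCosSub A) (i + 1) (j + 1) +
      expCoeff (mulCosSub A) (i + 2) j + 4 * expCoeff (mulCosSub A) i j = 0 := by
  have h := congrArg (fun F => expCoeff F i j) (pderiv_pderiv_mulCosSub A)
  have hadd (F G) : expCoeff (F + G) i j = expCoeff F i j + expCoeff G i j := by
    simp [expCoeff, mul_add]
  have hsub (F G) : expCoeff (F - G) i j = expCoeff F i j - expCoeff G i j := by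
    simp [expCoeff, mul_sub]
  have hmul (c : ℚ) (F) : expCoeff (MvPowerSeries.C c * F) i j = c * expCoeff F i j := by
    rw [expCoeff, expCoeff, MvPowerSeries.coeff_C_mul]
    ring
  rw [show (2 : MvPowerSeries (Fin 2) ℚ) = MvPowerSeries.C 2 from (map_ofNat _ 2).symm,
    show (4 : MvPowerSeries (Fin 2) ℚ) = MvPowerSeries.C 4 from (map_ofNat _ 4).symm] at h
  simp only [hadd, hsub, hmul, expCoeff_pderiv_zero, expCoeff_pderiv_one] at h
  rw [h]
  simp [expCoeff]

theorem expCoeff_mulCosSub_swap (A : PowerSeries ℚ) (i j : ℕ) :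
    expCoeff (mulCosSub A) i j = expCoeff (mulCosSub A) j i := by
  have h : swapVars (mulCosSub A) = mulCosSub A := by
    rw [mulCosSub, map_mul, swapVars_substAdd, swapVars_substSub_cos]
  rw [expCoeff, ← h, coeff_swapVars, h, expCoeff]
  ring

theorem expCoeff_mulCosSub_of_odd {A : PowerSeries ℚ} (hA : PowerSeries.rescale (-1 : ℚ) A = A)
    {i j : ℕ} (hij : Odd (i + j)) : expCoeff (mulCosSub A) i j = 0 := by
  have h : MvPowerSeries.rescale (fun _ => -1) (mulCosSub A) = mulCosSub A := by
    rw [mulCosSub, map_mul, rescale_neg_one_substAdd hA,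
      rescale_neg_one_substSub rescale_neg_one_cos]
  have := expCoeff_rescale (mulCosSub A) (fun _ => -1) i j
  rw [h, ← pow_add, hij.neg_one_pow] at this
  linarith

theorem expCoeff_mulCosSub_zero (A : PowerSeries ℚ) :
    expCoeff (mulCosSub A) 0 0 = constantCoeff A := by
  have h : MvPowerSeries.coeff 0 (mulCosSub A) = constantCoeff A := by
    rw [mulCosSub, MvPowerSeries.coeff_zero_eq_constantCoeff_apply, map_mul,
      ← MvPowerSeries.coeff_zero_eq_constantCoeff_apply,
      ← MvPowerSeries.coeff_zero_eq_constantCoeff_apply, coeff_substAdd, coeff_substSub]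
    simp [constantCoeff_cos]
  simp [expCoeff, h]

theorem expCoeff_mulCosSub_sec (m : ℕ) : expCoeff (mulCosSub secSeries) (m + 1) 0 = 0 := by
  -- Rescaling by `![1, 0]` sets `y = 0`, where the product is `sec x cos x`.
  have h : MvPowerSeries.rescale ![1, 0] (mulCosSub secSeries) = 1 := by
    rw [mulCosSub, map_mul, rescale_substSub, ← map_mul, ← substAdd_mul, secSeries_mul_cos,
      substAdd_one, map_one]
  have := expCoeff_rescale (mulCosSub secSeries) ![1, 0] (m + 1) 0
  rw [h] at this
  simp only [Matrix.cons_val_zero, one_pow, pow_zero, one_mul] at this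
  rw [← this, expCoeff, MvPowerSeries.coeff_one, if_neg, mul_zero]
  simp

theorem expCoeff_mulCosSub_sec_sq (m : ℕ) :
    expCoeff (mulCosSub (secSeries ^ 2)) m 1 =
      3 * expCoeff (mulCosSub (secSeries ^ 2)) (m + 1) 0 := by
  set Z := mulCosSub (secSeries ^ 2) with hZ
  have hB : derivative ℚ (secSeries ^ 2) * PowerSeries.cos ℚ =
      -2 * secSeries ^ 2 * derivative ℚ (PowerSeries.cos ℚ) := by
    rw [derivative_pow, derivative_secSeries]
    linear_combination
      -2 * secSeries ^ 2 * derivative ℚ (PowerSeries.cos ℚ) * secSeries_mul_cos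
  have hB' : substAdd (derivative ℚ (secSeries ^ 2)) * substAdd (PowerSeries.cos ℚ) =
      -2 * (substAdd (secSeries ^ 2) * substAdd (derivative ℚ (PowerSeries.cos ℚ))) := by
    rw [← substAdd_mul, hB, mul_assoc, ← substAdd_mul]
    ext e
    rw [show (-2 : PowerSeries ℚ) = C (-2) by rw [map_neg, map_ofNat],
      show (-2 : MvPowerSeries (Fin 2) ℚ) = MvPowerSeries.C (-2) by
        rw [map_neg, map_ofNat],
      MvPowerSeries.coeff_C_mul, coeff_substAdd, coeff_substAdd, coeff_C_mul]
    ring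
  -- With `B = sec²`, `hB` says `B' cos = -2 B cos'`. At `y = 0` this gives `∂_y Z = B' cos - B cos'
  -- = -3 B cos'` and `∂_x Z = B' cos + B cos' = -B cos'`.
  have h : MvPowerSeries.rescale ![1, 0] (pderiv ℚ 1 Z) =
      3 * MvPowerSeries.rescale ![1, 0] (pderiv ℚ 0 Z) := by
    rw [hZ, pderiv_one_mulCosSub, pderiv_zero_mulCosSub]
    simp only [map_add, map_sub, map_mul, rescale_substSub]
    simp only [← map_mul, hB']
    simp only [map_mul, map_neg, map_ofNat]
    ring
  have h1 := expCoeff_rescale (pderiv ℚ 1 Z) ![1, 0] m 0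
  have h0 := expCoeff_rescale (pderiv ℚ 0 Z) ![1, 0] m 0
  simp only [Matrix.cons_val_zero, one_pow, pow_zero, one_mul, expCoeff_pderiv_one,
    expCoeff_pderiv_zero, zero_add] at h0 h1
  rw [← h0, ← h1, h, show (3 : MvPowerSeries (Fin 2) ℚ) = MvPowerSeries.C 3 from
    (map_ofNat _ 3).symm, expCoeff, MvPowerSeries.coeff_C_mul, expCoeff]
  ring

/-! ### The triangles read off from the series -/

/-- The triangle whose generating function is `Z`. -/
noncomputable def triangleOf (Z : MvPowerSeries (Fin 2) ℚ) (n k : ℕ) : ℚ :=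
  expCoeff Z (2 * n - 1 - k) (k - 1)

theorem isDifferenceSolution_triangleOf (A : PowerSeries ℚ) :
    IsDifferenceSolution (triangleOf (mulCosSub A)) := by
  intro n k hn hk hkn
  obtain ⟨j, rfl⟩ : ∃ j, k = j + 1 := ⟨k - 1, by omega⟩
  -- `i` is the exponent of `x` for entry `k` of row `n - 1`, and also for entry `k + 2` of row `n`.
  obtain ⟨i, hi⟩ : ∃ i, 2 * n - 3 = i + (j + 1) := ⟨2 * n - 3 - (j + 1), by omega⟩
  have h := expCoeff_mulCosSub_recurrence A i j
  simp only [triangleOf]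
  rw [show 2 * n - 1 - (j + 1 + 2) = i by omega, show 2 * n - 1 - (j + 1 + 1) = i + 1 by omega,
    show 2 * n - 1 - (j + 1) = i + 2 by omega, show 2 * (n - 1) - 1 - (j + 1) = i by omega,
    show j + 1 + 2 - 1 = j + 2 by omega, Nat.add_sub_cancel, Nat.add_sub_cancel]
  exact h

/-- Summing the second differences over a row. -/
theorem IsDifferenceSolution.four_mul_rowSum {f : ℕ → ℕ → ℚ} (hf : IsDifferenceSolution f) {n : ℕ}
    (hn : 2 ≤ n) :
    4 * rowSum f (n - 1) = f n 2 - f n 1 - (f n (2 * n - 1) - f n (2 * n - 2)) := by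
  -- Partial sums of the row telescope; for `m = 0` the two differences coincide.
  have key (m : ℕ) (hm : m ≤ 2 * n - 3) :
      4 * ∑ k ∈ Finset.Icc 1 m, f (n - 1) k = f n 2 - f n 1 - (f n (m + 2) - f n (m + 1)) := by
    induction m with
    | zero => simp
    | succ m ih =>
      rw [Finset.sum_Icc_succ_top (by omega), mul_add, ih (by omega)]
      have := hf n (m + 1) hn (by omega) hm
      rw [show m + 1 + 2 = m + 3 by ring, show m + 1 + 1 = m + 2 by ring] at *
      linarith
  have := key (2 * n - 3) le_rfl
  rwa [show 2 * n - 3 + 2 = 2 * n - 1 by omega, show 2 * n - 3 + 1 = 2 * n - 2 by omega,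
    show 2 * n - 3 = 2 * (n - 1) - 1 by omega] at this

/-- The symmetry of `Z` reverses each row, so the last difference is minus the first and the
telescoped sum is twice the first. -/
theorem two_mul_rowSum_triangleOf (A : PowerSeries ℚ) {n : ℕ} (hn : 2 ≤ n) :
    2 * rowSum (triangleOf (mulCosSub A)) (n - 1) =
      triangleOf (mulCosSub A) n 2 - triangleOf (mulCosSub A) n 1 := by
  have h := (isDifferenceSolution_triangleOf A).four_mul_rowSum hn
  have h1 : triangleOf (mulCosSub A) n (2 * n - 1) = triangleOf (mulCosSub A) n 1 := by
    rw [triangleOf, expCoeff_mulCosSub_swap, triangleOf]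
    congr 1
    omega
  have h2 : triangleOf (mulCosSub A) n (2 * n - 2) = triangleOf (mulCosSub A) n 2 := by
    rw [triangleOf, expCoeff_mulCosSub_swap, triangleOf]
    congr 1
    omega
  rw [h1, h2] at h
  linarith

theorem constantCoeff_secSeries : constantCoeff secSeries = 1 := by
  simp [secSeries, constantCoeff_cos]

theorem isTangentTriangle_triangleOf : IsTangentTriangle (triangleOf (mulCosSub secSeries)) := by
  have first (n : ℕ) (hn : 2 ≤ n) : triangleOf (mulCosSub secSeries) n 1 = 0 := by
    rw [triangleOf, show 2 * n - 1 - 1 = 2 * n - 3 + 1 by omega]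
    exact expCoeff_mulCosSub_sec _
  refine ⟨isDifferenceSolution_triangleOf _, ?_, first, fun n hn => ?_⟩
  · exact (expCoeff_mulCosSub_zero _).trans constantCoeff_secSeries
  · rw [two_mul_rowSum_triangleOf _ hn, first n hn, sub_zero]

theorem isSecantTriangle_triangleOf :
    IsSecantTriangle (triangleOf (mulCosSub (secSeries ^ 2))) := by
  have ratio (n : ℕ) (hn : 2 ≤ n) : triangleOf (mulCosSub (secSeries ^ 2)) n 2 =
      3 * triangleOf (mulCosSub (secSeries ^ 2)) n 1 := by
    rw [triangleOf, triangleOf, show 2 * n - 1 - 1 = 2 * n - 1 - 2 + 1 by omega]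
    exact expCoeff_mulCosSub_sec_sq _
  refine ⟨isDifferenceSolution_triangleOf _, ?_, fun n hn => ?_, fun n hn => ?_⟩
  · refine (expCoeff_mulCosSub_zero _).trans ?_
    rw [map_pow, constantCoeff_secSeries, one_pow]
  -- With `S` the sum of the row above, `f_n(2) - f_n(1) = 2S` and `f_n(2) = 3 f_n(1)` force `f_n(1)
  -- = S` and `f_n(2) = 3S`.
  all_goals
    have h := two_mul_rowSum_triangleOf (secSeries ^ 2) hn
    have h' := ratio n hn
    linarith

/-! ### Uniqueness and conclusion -/

/-- A solution of the system is determined by the first two entries of its rows. -/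
theorem IsDifferenceSolution.eq_of_initial {f f' : ℕ → ℕ → ℚ} {c d : ℚ}
    (hf : IsDifferenceSolution f) (hf' : IsDifferenceSolution f') (apex : f 1 1 = f' 1 1)
    (first : ∀ n, 2 ≤ n → f n 1 = c * rowSum f (n - 1))
    (second : ∀ n, 2 ≤ n → f n 2 = d * rowSum f (n - 1))
    (first' : ∀ n, 2 ≤ n → f' n 1 = c * rowSum f' (n - 1))
    (second' : ∀ n, 2 ≤ n → f' n 2 = d * rowSum f' (n - 1))
    {n : ℕ} (hn : 1 ≤ n) : ∀ k, 1 ≤ k → k ≤ 2 * n - 1 → f n k = f' n k := by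
  induction n, hn using Nat.le_induction with
  | base =>
    intro k hk hk'
    obtain rfl : k = 1 := by omega
    exact apex
  | succ n hn ih =>
    have hS : rowSum f n = rowSum f' n :=
      Finset.sum_congr rfl fun k hk => ih k (Finset.mem_Icc.mp hk).1 (Finset.mem_Icc.mp hk).2
    intro k
    -- The recurrence uses the two preceding entries of the row, hence strong induction.
    induction k using Nat.strong_induction_on with
    | _ k ihk =>
      intro hk hk'
      match k, hk with
      | 1, _ => rw [first _ (by omega), first' _ (by omega), Nat.add_sub_cancel, hS]
      | 2, _ => rw [second _ (by omega), second' _ (by omega), Nat.add_sub_cancel, hS]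
      | k + 3, _ =>
        have h := hf (n + 1) (k + 1) (by omega) (by omega) (by omega)
        have h' := hf' (n + 1) (k + 1) (by omega) (by omega) (by omega)
        rw [Nat.add_sub_cancel, ih (k + 1) (by omega) (by omega),
          ihk (k + 1) (by omega) (by omega) (by omega),
          ihk (k + 1 + 1) (by omega) (by omega) (by omega)] at h
        rw [Nat.add_sub_cancel] at h'
        change f (n + 1) (k + 1 + 2) = f' (n + 1) (k + 1 + 2)
        linarith

theorem IsTangentTriangle.unique {f f' : ℕ → ℕ → ℚ} (hf : IsTangentTriangle f)
    (hf' : IsTangentTriangle f') {n k : ℕ} (hn : 1 ≤ n) (hk : 1 ≤ k) (hk' : k ≤ 2 * n - 1) :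
    f n k = f' n k :=
  hf.difference.eq_of_initial (c := 0) (d := 2) hf'.difference (hf.apex.trans hf'.apex.symm)
    (by simpa using hf.first) hf.second (by simpa using hf'.first) hf'.second hn k hk hk'

theorem IsSecantTriangle.unique {f f' : ℕ → ℕ → ℚ} (hf : IsSecantTriangle f)
    (hf' : IsSecantTriangle f') {n k : ℕ} (hn : 1 ≤ n) (hk : 1 ≤ k) (hk' : k ≤ 2 * n - 1) :
    f n k = f' n k :=
  hf.difference.eq_of_initial (c := 1) (d := 3) hf'.difference (hf.apex.trans hf'.apex.symm)
    (by simpa using hf.first) hf.second (by simpa using hf'.first) hf'.second hn k hk hk'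

/-- The double sum starts with row 2, so the constant term is matched through `hA1`. Evenness of `A`
kills the terms of odd total degree, which no row of the triangle covers. -/
theorem genFun_eq_mulCosSub {f : ℕ → ℕ → ℚ} {A : PowerSeries ℚ}
    (hA : PowerSeries.rescale (-1 : ℚ) A = A) (hA1 : constantCoeff A = 1)
    (h : ∀ n k, 1 ≤ n → 1 ≤ k → k ≤ 2 * n - 1 → f n k = triangleOf (mulCosSub A) n k) :
    genFun f = mulCosSub A := by
  refine ext_single fun i j => ?_
  have hZ : MvPowerSeries.coeff (Finsupp.single 0 i + Finsupp.single 1 j) (mulCosSub A) =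
      expCoeff (mulCosSub A) i j / (i.factorial * j.factorial) := by
    rw [expCoeff, mul_div_cancel_left₀]
    positivity
  have hgen : MvPowerSeries.coeff (Finsupp.single 0 i + Finsupp.single 1 j) (genSum f) =
      if Even (i + j) ∧ 1 ≤ (i + j) / 2 then
        f ((i + j) / 2 + 1) (j + 1) / (i.factorial * j.factorial) else 0 := by
    rw [MvPowerSeries.coeff_apply, genSum]
    simp
  rw [genFun, map_add, hgen, hZ, MvPowerSeries.coeff_one]
  rcases Nat.even_or_odd (i + j) with he | ho
  · by_cases h1 : 1 ≤ (i + j) / 2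
    · have hne : ¬ (Finsupp.single (0 : Fin 2) i + Finsupp.single 1 j = 0) := by
        intro h0
        have ha := DFunLike.congr_fun h0 0
        have hb := DFunLike.congr_fun h0 1
        simp at ha hb
        omega
      obtain ⟨m, hm⟩ := he
      rw [if_neg hne, if_pos ⟨⟨m, hm⟩, h1⟩, zero_add,
        h _ _ (by omega) (by omega) (by omega), triangleOf]
      congr 2
      omega
    · obtain ⟨m, hm⟩ := he
      obtain rfl : i = 0 := by omega
      obtain rfl : j = 0 := by omega
      simp [expCoeff_mulCosSub_zero, hA1]
  · rw [expCoeff_mulCosSub_of_odd hA ho, if_neg, if_neg, zero_div, add_zero]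
    · exact fun h' => Nat.not_even_iff_odd.mpr ho h'.1
    · intro h0
      have ha := DFunLike.congr_fun h0 0
      have hb := DFunLike.congr_fun h0 1
      simp at ha hb
      simp [ha, hb] at ho

theorem theorem1p2 (g h : ℕ → ℕ → ℚ) (hg : IsTangentTriangle g) (hh : IsSecantTriangle h) :
    genFun g =
        secSeries.subst (MvPowerSeries.X 0 + MvPowerSeries.X 1 : MvPowerSeries (Fin 2) ℚ) *
          (PowerSeries.cos ℚ).subst
            (MvPowerSeries.X 0 - MvPowerSeries.X 1 : MvPowerSeries (Fin 2) ℚ) ∧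
      genFun h =
        secSeries.subst (MvPowerSeries.X 0 + MvPowerSeries.X 1 : MvPowerSeries (Fin 2) ℚ) ^ 2 *
          (PowerSeries.cos ℚ).subst
            (MvPowerSeries.X 0 - MvPowerSeries.X 1 : MvPowerSeries (Fin 2) ℚ) := by
  constructor
  · exact genFun_eq_mulCosSub rescale_neg_one_secSeries constantCoeff_secSeries
      fun n k hn hk hk' => hg.unique isTangentTriangle_triangleOf hn hk hk'
  · refine (genFun_eq_mulCosSub (A := secSeries ^ 2) ?_ ?_ fun n k hn hk hk' =>
      hh.unique isSecantTriangle_triangleOf hn hk hk').trans ?_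
    · rw [map_pow, rescale_neg_one_secSeries]
    · rw [map_pow, constantCoeff_secSeries, one_pow]
    · rw [mulCosSub, substAdd_pow]
      rfl
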